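/- **Theorem 1.** Fix $d\ge 0$ and $\varepsilon>0$, and let $U$ be the uniform distribution on $[0,1]^d$. For latent codes $z_1,\dots,z_n\in\mathbb R^d$ let $\hat\mu_{gt}=\frac1n\sum_{i=1}^n\delta_{z_i}$ be the empirical latent distribution. Let $T$ be a semi-discrete optimal transport map from $U$ to $\hat\mu_{gt}$: $T_\#U=\hat\mu_{gt}$, and $\int\|w-T(w)\|^2\,dU$ is minimal among all maps that push $U$ forward to $\hat\mu_{gt}$. Let $W_i=\{w\in[0,1]^d: T(w)=z_i\}$ be its cells and $c_i$ the mass centre of $W_i$. Let $\sigma_\varepsilon$ be the Rips complex of dimension at most $d$ on the codes: a nonempty set $J$ of at most $d+1$ indices is a simplex if and only if $\|z_i-z_j\|\le\varepsilon$ for all distinct $i,j\in J$. For every $i$ let $\mathcal N_i$ be a family of sets of indices, the groups of neighbouring cells that are used for the points of $W_i$; the choice of the $\mathcal N_i$ is arbitrary. A *piecewise linear extension* of $T$ is a measurable map $\tilde T$ on $[0,1]^d$ such that for $U$-almost every $w$ there is a cell $W_i\ni w$ for which the following holds. If there are a set $J\in\mathcal N_i$ with $i\in J$ and $J\in\sigma_\varepsilon$,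 and numbers $\lambda_j\ge0$ $(j\in J)$ with $\sum_{j\in J}\lambda_j=1$ and $w=\sum_{j\in J}\lambda_jc_j$, then $\tilde T(w)=\sum_{j\in J}\lambda_jz_j$ for one such choice of $J$ and $\lambda$; otherwise $\tilde T(w)=z_i$. Put $\mu_\varepsilon=\tilde T_\#U$. Let $W_2$ be the 2-Wasserstein distance on $\mathbb R^d$, with values in $[0,\infty]$. 1. For all codes $z_1,\dots,z_n$ and every $\mu_\varepsilon$ so obtained, $W_2(\mu_\varepsilon,\hat\mu_{gt})\le\varepsilon$. 2. For every Borel probability measure $\mu_{gt}$ on $\mathbb R^d$, $W_2(\mu_\varepsilon,\mu_{gt})\le\varepsilon+W_2(\hat\mu_{gt},\mu_{gt})$. In particular $W_2(\mu_\varepsilon,\mu_{gt})\le2\varepsilon$ if the codes are so dense that $W_2(\hat\mu_{gt},\mu_{gt})\le\varepsilon$. 3. Let $\mu_{gt}$ be a Borel probability measure on $\mathbb R^d$ with finite second moment (for example the latent distribution on a compact latent manifold $\Omega\subset\mathbb R^d$), and let $z_1,z_2,\dots$ be independent random codes with law $\mu_{gt}$. Then, almost surely, there is an $N$ such that for every $n\ge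 N$ every measure $\mu_\varepsilon$ obtained from $z_1,\dots,z_n$ satisfies $W_2(\mu_\varepsilon,\mu_{gt})\le2\varepsilon$. -/

import Mathlib

open MeasureTheory ProbabilityTheory Filter
open scoped ENNReal

noncomputable section

namespace AEOT

/-- Euclidean space `ℝ^d`, the latent space. -/
abbrev E (d : ℕ) : Type := EuclideanSpace ℝ (Fin d)

/-- The unit cube `[0,1]^d`. -/
def cube (d : ℕ) : Set (E d) := {w | ∀ k, w k ∈ Set.Icc (0 : ℝ) 1}

/-- The uniform distribution on `[0,1]^d`. -/
def uniform (d : ℕ) : Measure (E d) := volume.restrict (cube d)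

/-- `π` is a coupling of `μ` and `ν`: its marginals are `μ` and `ν`. -/
def IsCoupling {d : ℕ} (μ ν : Measure (E d)) (π : Measure (E d × E d)) : Prop :=
  π.map Prod.fst = μ ∧ π.map Prod.snd = ν

/-- The 2-Wasserstein distance, with values in `[0,∞]`. -/
def W2 {d : ℕ} (μ ν : Measure (E d)) : ℝ≥0∞ :=
  (⨅ (π : Measure (E d × E d)) (_ : IsCoupling μ ν π),
    ∫⁻ p, edist p.1 p.2 ^ 2 ∂π) ^ (1 / 2 : ℝ)

/-- The empirical distribution `(1/n) ∑ δ_{z_i}` of the codes `z_1, …, z_n`. -/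
def empirical {d n : ℕ} (z : Fin n → E d) : Measure (E d) :=
  (n : ℝ≥0∞)⁻¹ • ∑ i, Measure.dirac (z i)

/-- `T` is an optimal transport map from `μ` to `ν` for the quadratic cost: it pushes `μ` forward
to `ν`, and no other transport map has a smaller cost. -/
structure IsOTMap {d : ℕ} (μ ν : Measure (E d)) (T : E d → E d) : Prop where
  aemeasurable : AEMeasurable T μ
  map_eq : μ.map T = ν
  optimal : ∀ S : E d → E d, AEMeasurable S μ → μ.map S = ν →
    ∫⁻ w, edist w (T w) ^ 2 ∂μ ≤ ∫⁻ w, edist w (S w) ^ 2 ∂μ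

/-- The cell `W_i`, the set of points of the cube that `T` sends to the code `z_i`. -/
def cell {d n : ℕ} (z : Fin n → E d) (T : E d → E d) (i : Fin n) : Set (E d) :=
  {w ∈ cube d | T w = z i}

/-- The mass centre `c_i` of the cell `W_i`. -/
def massCenter {d n : ℕ} (z : Fin n → E d) (T : E d → E d) (i : Fin n) : E d :=
  ⨍ w in cell z T i, w

/-- The Rips complex `σ_ε` of the codes: its vertices are the (indices of the) codes, and a simplex
of dimension at most `d` is a set of codes with pairwise distances at most `ε`. -/
def rips {d n : ℕ} (ε : ℝ) (z : Fin n → E d) : AbstractSimplicialComplex (Fin n) where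
  faces := {J | J.Nonempty ∧ J.card ≤ d + 1 ∧ ∀ i ∈ J, ∀ j ∈ J, i ≠ j → ‖z i - z j‖ ≤ ε}
  isRelLowerSet_faces := fun _ hJ => ⟨hJ.1, fun _ hle hne =>
    ⟨hne, (Finset.card_le_card hle).trans hJ.2.1,
      fun i hi j hj => hJ.2.2 i (hle hi) j (hle hj)⟩⟩
  singleton_mem := fun i => by
    refine ⟨Finset.singleton_nonempty i, by simp, ?_⟩
    intro a ha b hb hab
    exact absurd ((Finset.mem_singleton.mp ha).trans (Finset.mem_singleton.mp hb).symm) hab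

/-- `v` is the image of the point `w` of the cell `W_i` under linear interpolation over a group `J`
of cells: `J` consists of `W_i` and neighbouring cells (`nbhd i` is the family of groups from which
it may be taken), the codes in `J` form a simplex of `σ_ε`, `w = ∑ λ_j c_j` with barycentric
parameters `λ`, and `v = ∑ λ_j z_j`. -/
def Interpolates {d n : ℕ} (ε : ℝ) (z : Fin n → E d) (T : E d → E d)
    (nbhd : Fin n → Set (Finset (Fin n))) (i : Fin n) (w v : E d) : Prop :=
  ∃ J ∈ nbhd i, i ∈ J ∧ J ∈ rips ε z ∧ ∃ lam : Fin n → ℝ,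
    (∀ j ∈ J, 0 ≤ lam j) ∧ ∑ j ∈ J, lam j = 1 ∧
    w = ∑ j ∈ J, lam j • massCenter z T j ∧ v = ∑ j ∈ J, lam j • z j

/-- `T'` is a piecewise linear extension of the map `T`: a point `w` of the cell `W_i` is sent to
`∑ λ_j z_j` if `w = ∑ λ_j c_j` in barycentric parameters with respect to the mass centres of `W_i`
and some of its neighbours whose codes form a simplex of `σ_ε`, and to `z_i` otherwise. -/
structure IsPLExtension {d n : ℕ} (ε : ℝ) (z : Fin n → E d) (T : E d → E d)
    (nbhd : Fin n → Set (Finset (Fin n))) (T' : E d → E d) : Prop where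
  aemeasurable : AEMeasurable T' (uniform d)
  rule : ∀ᵐ w ∂uniform d, ∃ i, w ∈ cell z T i ∧
    (Interpolates ε z T nbhd i w (T' w) ∨
      ((¬ ∃ v, Interpolates ε z T nbhd i w v) ∧ T' w = z i))

/-- `μ` is one of the distributions `μ_ε` obtained from the codes `z`: the pushforward of the
uniform distribution under a piecewise linear extension of an optimal transport map `T` from the
uniform distribution to the empirical distribution of the codes. -/
def IsExtendedLatent {d n : ℕ} (ε : ℝ) (z : Fin n → E d) (μ : Measure (E d)) : Prop :=
  ∃ (T : E d → E d) (nbhd : Fin n → Set (Finset (Fin n))) (T' : E d → E d),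
    IsOTMap (uniform d) (empirical z) T ∧ IsPLExtension ε z T nbhd T' ∧
    μ = (uniform d).map T'

end AEOT

end

noncomputable section

namespace AEOT

/-! On a cell of `z i`, the extension takes either the value `z i` or a convex combination of codes
within `ε` of `z i`. So it stays within `ε` of `T` almost everywhere, and pushing the uniform
measure forward by both maps couples the two images at cost at most `ε`. The second claim is the
triangle inequality, needed only with a pushforward in the middle (`W2_map_le`).

For random codes it remains to bring the empirical measure `ν` within `ε` of `μgt`. Take a simple
function `q` close to the identity in `L²(μgt)`. The strong law, applied to the quantization cost
and to the finitely many fibres of `q`, shows that `ν` is close to its image under `q` and that this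
image dominates almost all of the image of `μgt`. `W2_sq_le_of_smul_map_le` turns this domination
into a distance bound. -/

lemma W2_le_of_isCoupling {d : ℕ} {μ ν : Measure (E d)} {π : Measure (E d × E d)}
    (h : IsCoupling μ ν π) : W2 μ ν ≤ (∫⁻ p, edist p.1 p.2 ^ 2 ∂π) ^ (1 / 2 : ℝ) :=
  ENNReal.rpow_le_rpow (iInf₂_le π h) (by norm_num)

/-- Truncated subtraction and squaring isolate the infimum, so no optimal coupling is needed. -/
lemma le_add_W2 {d : ℕ} {μ ν : Measure (E d)} {a b : ℝ≥0∞}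
    (h : ∀ π, IsCoupling μ ν π → b ≤ a + (∫⁻ p, edist p.1 p.2 ^ 2 ∂π) ^ (1 / 2 : ℝ)) :
    b ≤ a + W2 μ ν := by
  rw [← tsub_le_iff_left, W2, one_div, ENNReal.le_rpow_inv_iff two_pos]
  refine le_iInf₂ fun π hπ => ?_
  rw [← ENNReal.le_rpow_inv_iff two_pos, ← one_div, tsub_le_iff_left]
  exact h π hπ

/-- A coupling of `P.map g` with another measure lifts along `g` to the space of `P`. -/
lemma exists_lift_of_map_fst_eq {Ω X Y : Type*} [MeasurableSpace Ω] [MeasurableSpace X]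
    [MeasurableSpace Y] [StandardBorelSpace Y] [Nonempty Y] {P : Measure Ω} [IsFiniteMeasure P]
    {g : Ω → X} (hg : Measurable g) {π : Measure (X × Y)} (hπ : π.map Prod.fst = P.map g) :
    ∃ Q : Measure (Ω × Y), Q.map Prod.fst = P ∧ Q.map (Prod.map g id) = π := by
  have hfin : IsFiniteMeasure π := by
    have : IsFiniteMeasure (π.map Prod.fst) := by rw [hπ]; infer_instance
    exact ⟨by
      have := measure_lt_top (π.map Prod.fst) Set.univ
      rwa [Measure.map_apply measurable_fst MeasurableSet.univ, Set.preimage_univ] at this⟩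
  -- Draw `ω` from `P`, then the second coordinate from the disintegration of `π` at `g ω`.
  refine ⟨P ⊗ₘ (π.condKernel.comap g hg), Measure.fst_compProd P _, ?_⟩
  refine Measure.ext_of_lintegral _ fun h hh => ?_
  have hdis : π.fst ⊗ₘ π.condKernel = π := π.disintegrate π.condKernel
  rw [lintegral_map hh (by fun_prop), Measure.lintegral_compProd (by fun_prop)]
  conv_rhs => rw [← hdis, Measure.lintegral_compProd hh, Measure.fst, hπ]
  rw [lintegral_map (Measurable.lintegral_kernel_prod_right' hh) hg]
  simp [Kernel.comap_apply]

/-- Lift a coupling of `P.map g` and `lam` to the source, replace `g` by `f` in the first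
coordinate, and apply Minkowski's inequality in `L²` of the lift. -/
lemma W2_map_le {d : ℕ} {Ω : Type*} [MeasurableSpace Ω] {P : Measure Ω} [IsFiniteMeasure P]
    {f g : Ω → E d} (hf : AEMeasurable f P) (hg : AEMeasurable g P) (lam : Measure (E d)) :
    W2 (P.map f) lam ≤ (∫⁻ w, edist (f w) (g w) ^ 2 ∂P) ^ (1 / 2 : ℝ) + W2 (P.map g) lam := by
  wlog h : Measurable f ∧ Measurable g generalizing f g
  · have := this hf.measurable_mk.aemeasurable hg.measurable_mk.aemeasurable
      ⟨hf.measurable_mk, hg.measurable_mk⟩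
    rw [← Measure.map_congr hf.ae_eq_mk, ← Measure.map_congr hg.ae_eq_mk] at this
    convert this using 3
    refine lintegral_congr_ae ?_
    filter_upwards [hf.ae_eq_mk, hg.ae_eq_mk] with w h1 h2
    rw [← h1, ← h2]
  obtain ⟨hf, hg⟩ := h
  refine le_add_W2 fun π hπ => ?_
  obtain ⟨Q, hQ1, hQ2⟩ := exists_lift_of_map_fst_eq hg hπ.1
  have hc : IsCoupling (P.map f) lam (Q.map (Prod.map f id)) := by
    constructor
    · rw [Measure.map_map measurable_fst (by fun_prop), ← hQ1, Measure.map_map hf measurable_fst]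
      rfl
    · rw [← hπ.2, ← hQ2, Measure.map_map measurable_snd (by fun_prop),
        Measure.map_map measurable_snd (by fun_prop)]
      rfl
  refine (W2_le_of_isCoupling hc).trans ?_
  rw [lintegral_map (by fun_prop) (by fun_prop), ← hQ2, lintegral_map (by fun_prop) (by fun_prop),
    ← hQ1, lintegral_map (by fun_prop) (by fun_prop)]
  have hM := ENNReal.lintegral_Lp_add_le (μ := Q) (p := 2)
    (f := fun p => edist (f p.1) (g p.1)) (g := fun p => edist (g p.1) p.2)
    (by fun_prop) (by fun_prop) one_le_two
  simp only [ENNReal.rpow_two] at hM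
  refine le_trans (ENNReal.rpow_le_rpow (lintegral_mono fun p => ?_) (by norm_num)) hM
  simp only [Pi.add_apply, Prod.map_fst, Prod.map_snd, id]
  gcongr
  exact edist_triangle _ _ _

/-- Closeness of two maps in `L²` bounds the distance of the image measures. -/
lemma W2_map_map_le {d : ℕ} {Ω : Type*} [MeasurableSpace Ω] {P : Measure Ω}
    {f g : Ω → E d} (hf : AEMeasurable f P) (hg : AEMeasurable g P) :
    W2 (P.map f) (P.map g) ≤ (∫⁻ w, edist (f w) (g w) ^ 2 ∂P) ^ (1 / 2 : ℝ) := by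
  have hc : IsCoupling (P.map f) (P.map g) (P.map fun w => (f w, g w)) := by
    constructor
    · rw [AEMeasurable.map_map_of_aemeasurable (by fun_prop) (by fun_prop)]; rfl
    · rw [AEMeasurable.map_map_of_aemeasurable (by fun_prop) (by fun_prop)]; rfl
  refine (W2_le_of_isCoupling hc).trans_eq ?_
  rw [lintegral_map' (by fun_prop) (by fun_prop)]

/-! ### Piecewise linear extensions -/

lemma volume_cube (d : ℕ) : volume (cube d) = 1 := by
  have h : cube d = (WithLp.ofLp : E d → Fin d → ℝ) ⁻¹' Set.Icc 0 1 := by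
    ext w
    simp [cube, Set.mem_Icc, Pi.le_def, forall_and]
  rw [h, (PiLp.volume_preserving_ofLp (Fin d)).measure_preimage
    measurableSet_Icc.nullMeasurableSet, Real.volume_Icc_pi]
  simp

instance (d : ℕ) : IsProbabilityMeasure (uniform d) :=
  ⟨by rw [uniform, Measure.restrict_apply_univ, volume_cube]⟩

/-- Since `i ∈ J`, the closed ball about `z i` contains every code of the simplex, and it is convex.
-/
lemma Interpolates.dist_le {d n : ℕ} {ε : ℝ} {z : Fin n → E d} {T : E d → E d}
    {nbhd : Fin n → Set (Finset (Fin n))} {i : Fin n} {w v : E d} (hε : 0 ≤ ε)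
    (h : Interpolates ε z T nbhd i w v) : dist v (z i) ≤ ε := by
  obtain ⟨J, -, hiJ, hJ, lam, hpos, hsum, -, rfl⟩ := h
  refine (convex_closedBall (z i) ε).sum_mem hpos hsum fun j hj => ?_
  rw [Metric.mem_closedBall]
  obtain rfl | hne := eq_or_ne j i
  · simpa using hε
  · rw [dist_eq_norm]
    exact hJ.2.2 j hj i hiJ hne

lemma IsPLExtension.ae_dist_le {d n : ℕ} {ε : ℝ} {z : Fin n → E d} {T T' : E d → E d}
    {nbhd : Fin n → Set (Finset (Fin n))} (hε : 0 ≤ ε) (h : IsPLExtension ε z T nbhd T') :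
    ∀ᵐ w ∂uniform d, dist (T' w) (T w) ≤ ε := by
  filter_upwards [h.rule] with w hw
  obtain ⟨i, hi, hI | ⟨-, hI⟩⟩ := hw
  · rw [hi.2]
    exact hI.dist_le hε
  · rwa [hI, hi.2, dist_self]

lemma IsPLExtension.cost_le {d n : ℕ} {ε : ℝ} {z : Fin n → E d} {T T' : E d → E d}
    {nbhd : Fin n → Set (Finset (Fin n))} (hε : 0 ≤ ε) (h : IsPLExtension ε z T nbhd T') :
    (∫⁻ w, edist (T' w) (T w) ^ 2 ∂uniform d) ^ (1 / 2 : ℝ) ≤ ENNReal.ofReal ε := by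
  rw [one_div, ENNReal.rpow_inv_le_iff two_pos, ENNReal.rpow_two]
  calc ∫⁻ w, edist (T' w) (T w) ^ 2 ∂uniform d
      ≤ ∫⁻ _, ENNReal.ofReal ε ^ 2 ∂uniform d := by
        refine lintegral_mono_ae ?_
        filter_upwards [h.ae_dist_le hε] with w hw
        gcongr
        rw [edist_dist]
        exact ENNReal.ofReal_le_ofReal hw
    _ = ENNReal.ofReal ε ^ 2 := by simp

lemma IsExtendedLatent.W2_empirical_le {d n : ℕ} {ε : ℝ} {z : Fin n → E d} {μ : Measure (E d)}
    (hε : 0 ≤ ε) (h : IsExtendedLatent ε z μ) : W2 μ (empirical z) ≤ ENNReal.ofReal ε := by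
  obtain ⟨T, nbhd, T', hT, hT', rfl⟩ := h
  rw [← hT.map_eq]
  exact (W2_map_map_le hT'.aemeasurable hT.aemeasurable).trans (hT'.cost_le hε)

lemma IsExtendedLatent.W2_le {d n : ℕ} {ε : ℝ} {z : Fin n → E d} {μ : Measure (E d)}
    (hε : 0 ≤ ε) (h : IsExtendedLatent ε z μ) (μgt : Measure (E d)) :
    W2 μ μgt ≤ ENNReal.ofReal ε + W2 (empirical z) μgt := by
  obtain ⟨T, nbhd, T', hT, hT', rfl⟩ := h
  rw [← hT.map_eq]
  exact (W2_map_le hT'.aemeasurable hT.aemeasurable μgt).trans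
    (add_le_add_left (hT'.cost_le hε) _)

/-! ### Convergence of empirical measures -/

/-- If `c • q_* μ` is contained in `N`, then transporting that part of `N` back along `q` and the
rest independently bounds the distance of `N` and `μ`. -/
lemma W2_sq_le_of_smul_map_le {d : ℕ} {μ N : Measure (E d)} [IsProbabilityMeasure μ]
    [IsProbabilityMeasure N] {q : E d → E d} (hq : Measurable q) {c K : ℝ≥0∞} (hc : c ≤ 1)
    (hle : c • μ.map q ≤ N) (hK : ∀ᵐ y ∂N, ∫⁻ x, edist y x ^ 2 ∂μ ≤ K) :
    W2 N μ ≤ (∫⁻ x, edist x (q x) ^ 2 ∂μ + (1 - c) * K) ^ (1 / 2 : ℝ) := by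
  set M := c • μ.map q with hM
  have hMfin : IsFiniteMeasure M := ⟨(hle _).trans_lt (measure_lt_top _ _)⟩
  have hMuniv : M Set.univ = c := by
    rw [hM, Measure.smul_apply, Measure.map_apply hq MeasurableSet.univ]; simp
  have huniv : (N - M) Set.univ = 1 - c := by
    rw [Measure.sub_apply MeasurableSet.univ hle, hMuniv, measure_univ]
  have hcoup : IsCoupling N μ (c • μ.map (fun x => (q x, x)) + (N - M).prod μ) := by
    constructor
    · rw [Measure.map_add _ _ measurable_fst, Measure.map_smul,
        Measure.map_map measurable_fst (by fun_prop), Measure.map_fst_prod, measure_univ, one_smul,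
        add_comm]
      exact Measure.sub_add_cancel_of_le hle
    · rw [Measure.map_add _ _ measurable_snd, Measure.map_smul,
        Measure.map_map measurable_snd (by fun_prop), Measure.map_snd_prod, huniv]
      change c • μ.map id + (1 - c) • μ = μ
      rw [Measure.map_id, ← add_smul, add_tsub_cancel_of_le hc, one_smul]
  refine (W2_le_of_isCoupling hcoup).trans (ENNReal.rpow_le_rpow ?_ (by norm_num))
  rw [lintegral_add_measure, lintegral_smul_measure, lintegral_map (by fun_prop) (by fun_prop),
    lintegral_prod _ (by fun_prop)]
  refine add_le_add ?_ ?_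
  · simp_rw [edist_comm (q _), smul_eq_mul]
    exact mul_le_of_le_one_left' hc
  · calc ∫⁻ y, ∫⁻ x, edist y x ^ 2 ∂μ ∂(N - M) ≤ ∫⁻ _, K ∂(N - M) :=
          lintegral_mono_ae (Measure.absolutelyContinuous_of_le Measure.sub_le hK)
      _ = (1 - c) * K := by rw [lintegral_const, huniv, mul_comm]

/-- Finite range reduces domination to single fibres, so finitely many uses of the strong law
suffice. -/
lemma smul_map_simpleFunc_le {X Y : Type*} [MeasurableSpace X] [MeasurableSpace Y]
    [MeasurableSingletonClass Y] {μ ν : Measure X} (q : SimpleFunc X Y) {c : ℝ≥0∞}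
    (h : ∀ a ∈ q.range, c * μ (q ⁻¹' {a}) ≤ ν (q ⁻¹' {a})) : c • μ.map q ≤ ν.map q := by
  classical
  refine Measure.le_iff.2 fun s hs => ?_
  have hpre : q ⁻¹' s = q ⁻¹' (q.range.filter (· ∈ s) : Finset Y) := by
    ext x; simp
  rw [Measure.smul_apply, Measure.map_apply q.measurable hs, Measure.map_apply q.measurable hs,
    hpre, ← q.sum_measure_preimage_singleton, ← q.sum_measure_preimage_singleton, smul_eq_mul,
    Finset.mul_sum]
  exact Finset.sum_le_sum fun a ha => h a (Finset.mem_filter.1 ha).1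

lemma lintegral_empirical {d n : ℕ} (z : Fin n → E d) {f : E d → ℝ≥0∞} (hf : Measurable f) :
    ∫⁻ x, f x ∂empirical z = (n : ℝ≥0∞)⁻¹ * ∑ i, f (z i) := by
  simp [empirical, lintegral_smul_measure, lintegral_dirac' _ hf]

lemma isProbabilityMeasure_empirical {d n : ℕ} (hn : n ≠ 0) (z : Fin n → E d) :
    IsProbabilityMeasure (empirical z) := ⟨by
  rw [← lintegral_one, lintegral_empirical z measurable_const]
  simp [ENNReal.inv_mul_cancel (Nat.cast_ne_zero.2 hn) (ENNReal.natCast_ne_top n)]⟩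

section Sampling

variable {d : ℕ} {S : Type*} [MeasurableSpace S] {P : Measure S} {μ : Measure (E d)}
  {Z : ℕ → S → E d}

lemma ae_tendsto_lintegral_empirical (hZ : ∀ k, Measurable (Z k)) (hlaw : ∀ k, P.map (Z k) = μ)
    (hind : iIndepFun Z P) {f : E d → NNReal} (hf : Measurable f) (hfin : ∫⁻ x, f x ∂μ ≠ ∞) :
    ∀ᵐ s ∂P, Tendsto (fun n : ℕ => ∫⁻ x, f x ∂empirical (fun i : Fin n => Z i s)) atTop
      (nhds (∫⁻ x, f x ∂μ)) := by
  have hint : Integrable (fun x => (f x : ℝ)) μ :=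
    ⟨by fun_prop, by simpa [HasFiniteIntegral, enorm] using hfin.lt_top⟩
  have hslln := strong_law_ae_real (μ := P) (fun i s => (f (Z i s) : ℝ))
    (by
      rw [← hlaw 0] at hint
      exact hint.comp_measurable (hZ 0))
    (fun i j hij => (hind.indepFun hij).comp (φ := fun x => (f x : ℝ)) (ψ := fun x => (f x : ℝ))
      (by fun_prop) (by fun_prop))
    (fun i => IdentDistrib.comp (u := fun x => (f x : ℝ))
      ⟨(hZ i).aemeasurable, (hZ 0).aemeasurable, by rw [hlaw, hlaw]⟩ (by fun_prop))
  have hmean : ENNReal.ofReal (∫ s, (f (Z 0 s) : ℝ) ∂P) = ∫⁻ x, f x ∂μ := by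
    rw [← integral_map (φ := Z 0) (f := fun x => (f x : ℝ)) (hZ 0).aemeasurable (by fun_prop),
      hlaw 0, ofReal_integral_eq_lintegral_ofReal hint (ae_of_all _ fun x => (f x).2)]
    simp
  filter_upwards [hslln] with s hs
  rw [← hmean]
  refine ((ENNReal.continuous_ofReal.tendsto _).comp hs).congr' ?_
  filter_upwards [eventually_gt_atTop 0] with n hn
  rw [lintegral_empirical _ (by fun_prop), Function.comp_apply,
    ENNReal.ofReal_div_of_pos (by exact_mod_cast hn), ENNReal.div_eq_inv_mul,
    ENNReal.ofReal_sum_of_nonneg (fun i _ => NNReal.coe_nonneg _), ENNReal.ofReal_natCast,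
    Finset.sum_range]
  simp

lemma ae_tendsto_empirical_apply (hZ : ∀ k, Measurable (Z k)) [IsFiniteMeasure μ]
    (hlaw : ∀ k, P.map (Z k) = μ) (hind : iIndepFun Z P) {A : Set (E d)} (hA : MeasurableSet A) :
    ∀ᵐ s ∂P, Tendsto (fun n : ℕ => empirical (fun i : Fin n => Z i s) A) atTop
      (nhds (μ A)) := by
  have h (ν : Measure (E d)) : ∫⁻ x, ((A.indicator 1 x : NNReal) : ℝ≥0∞) ∂ν = ν A := by
    simp [ENNReal.coe_indicator, lintegral_indicator hA]
  have := ae_tendsto_lintegral_empirical hZ hlaw hind (f := A.indicator 1)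
    (measurable_one.indicator hA) (by rw [h]; exact measure_ne_top _ _)
  simpa only [h] using this

/-- Empirical measures of independent samples converge to the sampled one in `W₂` if the second moment is finite. -/
lemma ae_eventually_W2_empirical_le [IsProbabilityMeasure μ] (hZ : ∀ k, Measurable (Z k))
    (hlaw : ∀ k, P.map (Z k) = μ) (hind : iIndepFun Z P)
    (hmom : MemLp (fun x : E d => x) 2 μ) {e : ℝ≥0∞} (he : e ≠ 0) :
    ∀ᵐ s ∂P, ∀ᶠ n : ℕ in atTop, W2 (empirical (fun i : Fin n => Z i s)) μ ≤ e := by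
  have hmemLp {g : E d → E d} (hg : MemLp g 2 μ) :
      ∫⁻ x, edist (g x) 0 ^ 2 ∂μ = eLpNorm g 2 μ ^ 2 := by
    rw [eLpNorm_eq_lintegral_rpow_enorm_toReal two_ne_zero ENNReal.ofNat_ne_top,
      ← ENNReal.rpow_two, ← ENNReal.rpow_mul]
    simp [edist_zero_right]
  have hcost {g h : E d → E d} (hg : MemLp g 2 μ) (hh : MemLp h 2 μ) :
      ∫⁻ x, edist (g x) (h x) ^ 2 ∂μ = eLpNorm (g - h) 2 μ ^ 2 := by
    rw [← hmemLp (hg.sub hh)]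
    simp [edist_eq_enorm_sub]
  obtain ⟨q, hqlt, hqmem⟩ := hmom.exists_simpleFunc_eLpNorm_sub_lt ENNReal.ofNat_ne_top
    (ε := e / 2) (ENNReal.half_pos he).ne'
  set α := ∫⁻ x, edist x (q x) ^ 2 ∂μ with hα
  have hαlt : α < (e / 2) ^ 2 := by
    rw [hα, hcost hmom hqmem]
    exact ENNReal.pow_lt_pow_left two_ne_zero hqlt
  -- Summing over the values of `q` bounds the cost of spreading any one of them over `μ`.
  set K := ∑ a ∈ q.range, ∫⁻ x, edist a x ^ 2 ∂μ
  have hKtop : K ≠ ∞ := ENNReal.sum_ne_top.2 fun a _ => by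
    rw [hcost (memLp_const a) hmom]
    exact ENNReal.pow_ne_top ((memLp_const a).sub hmom).2.ne
  -- The strict bound on `α` leaves room for the cost `(1 - c) * K` of the unmatched mass; capping
  -- `t` at `1` keeps `c` from being truncated.
  obtain ⟨t, ht0, ht⟩ := ENNReal.exists_nnreal_pos_mul_lt hKtop (tsub_pos_of_lt hαlt).ne'
  have htpos : (0 : ℝ≥0∞) < min (t : ℝ≥0∞) 1 := lt_min (by exact_mod_cast ht0) one_pos
  set c : ℝ≥0∞ := 1 - min (t : ℝ≥0∞) 1
  have hc1 : 1 - c = min (t : ℝ≥0∞) 1 := ENNReal.sub_sub_cancel ENNReal.one_ne_top (min_le_right _ _)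
  have hclt : c < 1 := ENNReal.sub_lt_self ENNReal.one_ne_top one_ne_zero htpos.ne'
  have hcK : α + (1 - c) * K ≤ (e / 2) ^ 2 := by
    rw [hc1]
    calc α + min (t : ℝ≥0∞) 1 * K ≤ α + ((e / 2) ^ 2 - α) := by
          gcongr
          exact (mul_le_mul_left (min_le_left _ _) K).trans ht.le
      _ = (e / 2) ^ 2 := add_tsub_cancel_of_le hαlt.le
  have hcells : ∀ᵐ s ∂P, ∀ a ∈ q.range, Tendsto
      (fun n : ℕ => empirical (fun i : Fin n => Z i s) (q ⁻¹' {a})) atTop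
      (nhds (μ (q ⁻¹' {a}))) := by
    rw [Filter.eventually_all_finset]
    exact fun a _ => ae_tendsto_empirical_apply hZ hlaw hind (q.measurableSet_preimage _)
  have hquant := ae_tendsto_lintegral_empirical hZ hlaw hind
    (f := fun x => nndist x (q x) ^ 2) ((measurable_id.nndist q.measurable).pow_const 2)
    (by simpa [← edist_nndist] using (hαlt.trans_le le_top).ne)
  simp only [ENNReal.coe_pow, ← edist_nndist] at hquant
  filter_upwards [hcells, hquant] with s hcells hquant
  have hcells' : ∀ᶠ n : ℕ in atTop, ∀ a ∈ q.range,
      c * μ (q ⁻¹' {a}) ≤ empirical (fun i : Fin n => Z i s) (q ⁻¹' {a}) := by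
    rw [Filter.eventually_all_finset]
    intro a ha
    -- A null fibre is trivial; on the others `c < 1` gives the strict gap needed to pass from the
    -- limit to large `n`.
    obtain h0 | h0 := eq_or_ne (μ (q ⁻¹' {a})) 0
    · simp [h0]
    · have hlt : c * μ (q ⁻¹' {a}) < μ (q ⁻¹' {a}) := by
        simpa using ENNReal.mul_lt_mul_left h0 (measure_ne_top _ _) hclt
      exact ((hcells a ha).eventually (lt_mem_nhds hlt)).mono fun n hn => hn.le
  filter_upwards [hcells', hquant.eventually (gt_mem_nhds hαlt), eventually_ne_atTop 0]
    with n hn1 hn2 hn0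
  have := isProbabilityMeasure_empirical hn0 (fun i : Fin n => Z i s)
  set ν := empirical (fun i : Fin n => Z i s)
  have := Measure.isProbabilityMeasure_map (μ := ν) q.measurable.aemeasurable
  have hfar : ∀ᵐ y ∂ν.map q, ∫⁻ x, edist y x ^ 2 ∂μ ≤ K := by
    rw [ae_map_iff q.measurable.aemeasurable (measurableSet_le (by fun_prop) measurable_const)]
    exact ae_of_all _ fun x => Finset.single_le_sum
      (f := fun a => ∫⁻ x, edist a x ^ 2 ∂μ) (fun _ _ => zero_le) (q.mem_range_self x)
  have hhalf {b : ℝ≥0∞} (hb : b ≤ (e / 2) ^ 2) : b ^ (1 / 2 : ℝ) ≤ e / 2 := by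
    rwa [one_div, ENNReal.rpow_inv_le_iff two_pos, ENNReal.rpow_two]
  calc W2 ν μ = W2 (ν.map id) μ := by rw [Measure.map_id]
    _ ≤ (∫⁻ x, edist x (q x) ^ 2 ∂ν) ^ (1 / 2 : ℝ) + W2 (ν.map q) μ :=
        W2_map_le aemeasurable_id q.measurable.aemeasurable μ
    _ ≤ e / 2 + e / 2 := add_le_add (hhalf hn2.le) <|
        (W2_sq_le_of_smul_map_le q.measurable hclt.le (smul_map_simpleFunc_le q hn1) hfar).trans
          (hhalf hcK)
    _ = e := ENNReal.add_halves e

end Sampling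

end AEOT

end

theorem theorem1 (d : ℕ) (ε : ℝ) (hε : 0 < ε) :
    -- the distance between `μ_ε` and the empirical latent distribution
    (∀ (n : ℕ) (z : Fin n → AEOT.E d) (μ : Measure (AEOT.E d)),
      AEOT.IsExtendedLatent ε z μ →
        AEOT.W2 μ (AEOT.empirical z) ≤ ENNReal.ofReal ε) ∧
    -- codes that represent `μgt` up to `ε`
    (∀ (n : ℕ) (z : Fin n → AEOT.E d) (μ μgt : Measure (AEOT.E d)),
      IsProbabilityMeasure μgt → AEOT.IsExtendedLatent ε z μ →
        AEOT.W2 μ μgt ≤ ENNReal.ofReal ε + AEOT.W2 (AEOT.empirical z) μgt) ∧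
    -- dense random sampling: almost surely, for all sufficiently many codes
    (∀ (S : Type*) [MeasurableSpace S] (P : Measure S) [IsProbabilityMeasure P]
      (μgt : Measure (AEOT.E d)) [IsProbabilityMeasure μgt] (Z : ℕ → S → AEOT.E d),
      MemLp (fun x : AEOT.E d => x) 2 μgt →
      (∀ k, Measurable (Z k)) → (∀ k, P.map (Z k) = μgt) → iIndepFun Z P →
        ∀ᵐ s ∂P, ∀ᶠ n : ℕ in atTop, ∀ μ : Measure (AEOT.E d),
          AEOT.IsExtendedLatent ε (fun i : Fin n => Z i s) μ →
            AEOT.W2 μ μgt ≤ ENNReal.ofReal (2 * ε)) := by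
  refine ⟨fun n z μ h => h.W2_empirical_le hε.le, fun n z μ μgt _ h => h.W2_le hε.le μgt, ?_⟩
  intro S _ P _ μgt _ Z hmom hZ hlaw hind
  -- The null set and the threshold depend only on the samples, hence serve all extensions at once.
  filter_upwards [AEOT.ae_eventually_W2_empirical_le hZ hlaw hind hmom
    (ENNReal.ofReal_pos.2 hε).ne'] with s hs
  filter_upwards [hs] with n hn μ h
  calc AEOT.W2 μ μgt
      ≤ ENNReal.ofReal ε + AEOT.W2 (AEOT.empirical fun i : Fin n => Z i s) μgt :=
        h.W2_le hε.le μgt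
    _ ≤ ENNReal.ofReal ε + ENNReal.ofReal ε := by gcongr
    _ = ENNReal.ofReal (2 * ε) := by rw [← ENNReal.ofReal_add hε.le hε.le, two_mul]
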